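/- Let $H$ be a finite bipartite simple graph with partite sets $U=\{u_1,\dots,u_x\}$ and $V=\{v_1,\dots,v_y\}$ (each listed in a fixed order; $U\cap V=\emptyset$, $U\cup V=V(H)$, every edge of $H$ joins $U$ to $V$). Let $t=|V(H)|=x+y$ and let $q$ be the minimum size of a vertex cover of $H$. For a positive integer $n$ and a graph $G$ on the vertex set $\{1,\dots,n\}$, let $R_H=R_H(G)$ be the $\binom nx\times\binom ny$ real matrix whose rows are indexed by the $x$-element subsets $A=\{a_1<\dots<a_x\}$ and whose columns are indexed by the $y$-element subsets $B=\{b_1<\dots<b_y\}$ of $\{1,\dots,n\}$, with entries $$R_H(A,B)=\prod_{\{u_i,v_j\}\in E(H)} g(a_i,b_j)\ \text{ if } A\cap B=\emptyset,\qquad R_H(A,B)=0\ \text{ otherwise},$$ where $g(a,b)=1$ if $\{a,b\}\in E(G)$ and $g(a,b)=-1$ otherwise. Let $\|\cdot\|$ denote the spectral norm (the operator norm with respect to Euclidean norms). Then: 1. For every graph $G$ on $\{1,\dots,n\}$, $\|R_H\|\le n^{t/2}$. 2. If $q\ge 1$ and $G$ is drawn from the Erdős–Rényi distribution $G(n,1/2)$,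 then for all $\varepsilon\in(0,1)$, $$\mathbb P\left[\|R_H\|>2t^t\left(et\left(\frac{\ln(8n^q/\varepsilon)}{2q}+1\right)\right)^{q}n^{\frac{t-q}{2}}\right]<\varepsilon .$$ -/

import Mathlib

open scoped Matrix.Norms.L2Operator

namespace GraphMatrix

/-- The `k`-element subsets of `{1, …, n}` (realised as `Fin n`), indexing rows and columns. -/
abbrev KSubset (n k : ℕ) : Type := {s : Finset (Fin n) // s.card = k}

/-- The elements of `A` listed in increasing order. -/
def KSubset.list {n k : ℕ} (A : KSubset n k) : Fin k → Fin n :=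
  A.1.orderEmbOfFin A.2

open Classical in
/-- The edge variable of a possible edge `e`: `1` if `e` is an edge of `G` and `-1` otherwise. -/
noncomputable def edgeVar {n : ℕ} (G : SimpleGraph (Fin n)) (e : Sym2 (Fin n)) : ℝ :=
  if e ∈ G.edgeSet then 1 else -1

/-- The character `χ_E`: the product of the edge variables over the set `E`. -/
noncomputable def chi {n : ℕ} (G : SimpleGraph (Fin n)) (E : Finset (Sym2 (Fin n))) : ℝ :=
  ∏ e ∈ E, edgeVar G e

open Classical in
/-- The graph matrix `R_H` of a graph `H` with distinguished vertex lists `u₁, …, u_x` and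
`v₁, …, v_y`, as a function of the input graph `G` on `n` ordered vertices.

The `(A, B)` entry is the sum of `χ_{π(E(H))}` over all injections `π` of the vertices of `H`
into those of `G` with `π(uᵢ) = aᵢ` and `π(vⱼ) = bⱼ`, where `a` and `b` list `A` and `B` in
increasing order. Such a `π` is the same as a choice of pairwise distinct images, outside `A ∪ B`,
of the vertices of `H` that are neither in `U` nor in `V`; there is none (and the entry is `0`)
unless `aᵢ = bⱼ ↔ uᵢ = vⱼ` for all `i, j`. -/
noncomputable def R {α : Type*} [Fintype α] (H : SimpleGraph α) {x y : ℕ}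
    (u : Fin x ↪ α) (v : Fin y ↪ α) {n : ℕ} (G : SimpleGraph (Fin n)) :
    Matrix (KSubset n x) (KSubset n y) ℝ :=
  Matrix.of fun A B =>
    ∑ π : α ↪ Fin n with (∀ i, π (u i) = A.list i) ∧ (∀ j, π (v j) = B.list j),
      chi G (H.edgeFinset.map π.sym2Map)

/-- The law of the random graph `G(n, 1/2)`. -/
noncomputable def gnHalf (n : ℕ) : MeasureTheory.Measure (SimpleGraph (Fin n)) :=
  SimpleGraph.binomialRandom (Fin n) ⟨1 / 2, by norm_num, by norm_num⟩

end GraphMatrix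

/-! The first bound is the Frobenius norm. The second is the moment method: `‖R‖ ^ (2k)` is at most
the trace of `(R Rᵀ) ^ k`, a sum over closed walks, and in the mean only walks using every edge of
`G` an even number of times survive. To keep different edges of `H` from pairing up, `R` is written
as an average over colourings `c : Fin n → α` of matrices that keep only embeddings with left
inverse `c` (`sum_coloredR`); this costs a factor `t ^ t`. In a coloured walk each edge of `H` has
`2k` images, each repeated evenly, hence at most `k` distinct ones, and its two ends visit at most
`k + 1` vertices (`card_image_le_of_sum_ne_zero`).

Kőnig's theorem gives `q` disjoint edges of `H`. Each matched pair of vertices has at most `n ^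
(k+1) * (k+1) ^ (2k)` trajectories, each other vertex `n ^ k`, so the mean of `‖R‖ ^ (2k)` is at
most `t ^ (2kt) * n ^ q * (k+1) ^ (2kq) * n ^ (k(t-q))`. Markov's inequality with `k` about `log (8
n ^ q / ε) / (2q)` finishes. -/

/-! ### Traces of powers and the spectral norm. -/

namespace Matrix

/-- The entries of a power of a matrix as a sum over walks. -/
theorem pow_apply_eq_sum_walks {I R : Type*} [Fintype I] [DecidableEq I] [CommSemiring R]
    (N : Matrix I I R) (k : ℕ) (i j : I) :
    (N ^ k) i j = ∑ f : Fin (k + 1) → I,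
      if f 0 = i ∧ f (Fin.last k) = j then ∏ s : Fin k, N (f s.castSucc) (f s.succ) else 0 := by
  induction k generalizing i with
  | zero =>
    rw [pow_zero, ← (Equiv.funUnique (Fin 1) I).symm.sum_comp]
    simp only [one_apply, Finset.univ_eq_empty, Finset.prod_empty]
    by_cases h : i = j
    · subst h
      simp
    · rw [if_neg h, Finset.sum_eq_zero]
      intro a _
      rw [if_neg]
      rintro ⟨h1, h2⟩
      exact h (h1.symm.trans h2)
  | succ k ih =>
    rw [pow_succ', mul_apply, ← (Fin.consEquiv (fun _ : Fin (k + 2) => I)).sum_comp,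
      Fintype.sum_prod_type]
    simp only [Fin.consEquiv, Equiv.coe_fn_mk, Fin.cons_zero, Fin.prod_univ_succ,
      Fin.castSucc_zero, Fin.cons_succ, ← Fin.succ_last]
    symm
    rw [Finset.sum_eq_single i]
    · symm
      simp only [ih, Finset.mul_sum]
      rw [Finset.sum_comm]
      refine Finset.sum_congr rfl fun f _ => ?_
      rw [Finset.sum_eq_single (f 0)]
      · simp
      · intro l _ hl
        rw [if_neg (fun h => hl h.1.symm), mul_zero]
      · simp
    · intro l _ hl
      exact Finset.sum_eq_zero fun f _ => if_neg fun h => hl h.1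
    · simp

/-- The trace of a power of `M Mᵀ` as a sum over closed walks. -/
theorem trace_mul_transpose_pow {I J R : Type*} [Fintype I] [DecidableEq I] [Fintype J]
    [DecidableEq J] [CommSemiring R] (M : Matrix I J R) (k : ℕ) :
    ((M * Mᵀ) ^ k).trace = ∑ w : (Fin (k + 1) → I) × (Fin k → J),
      if w.1 0 = w.1 (Fin.last k) then
        ∏ s : Fin k, M (w.1 s.castSucc) (w.2 s) * M (w.1 s.succ) (w.2 s) else 0 := by
  simp only [trace, diag_apply, pow_apply_eq_sum_walks, mul_apply, transpose_apply]
  rw [Finset.sum_comm, Fintype.sum_prod_type]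
  refine Finset.sum_congr rfl fun f _ => ?_
  rw [Finset.sum_eq_single (f 0)]
  · by_cases h : f 0 = f (Fin.last k)
    · simp only [← h, and_self, if_true]
      rw [Finset.prod_univ_sum, Fintype.piFinset_univ]
    · simp [h, Ne.symm h]
  · intro i _ hi
    exact if_neg fun h => hi h.1.symm
  · simp

/-- The moment bound for the spectral norm. -/
theorem l2_opNorm_pow_le_trace {I J : Type*} [Fintype I] [DecidableEq I] [Fintype J]
    [DecidableEq J] (M : Matrix I J ℝ) {k : ℕ} (hk : k ≠ 0) :
    ‖M‖ ^ (2 * k) ≤ ((M * Mᵀ) ^ k).trace := by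
  have hN : (M * Mᵀ).PosSemidef := by
    simpa using posSemidef_self_mul_conjTranspose M
  have hnorm : ‖M * Mᵀ‖ = ‖M‖ ^ 2 := by
    have := l2_opNorm_conjTranspose_mul_self (Mᵀ)
    rw [conjTranspose_eq_transpose_of_trivial, transpose_transpose] at this
    rw [this, ← conjTranspose_eq_transpose_of_trivial, l2_opNorm_conjTranspose, sq]
  rw [pow_mul, ← hnorm]
  set N := M * Mᵀ
  have hH := hN.isHermitian
  have hspec := hH.spectral_theorem
  have hsum : (N ^ k).trace = ∑ i, hH.eigenvalues i ^ k := by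
    conv_lhs => rw [hspec]
    rw [← map_pow, Unitary.conjStarAlgAut_apply, trace_mul_cycle]
    simp [diagonal_pow, trace_diagonal]
  have hle : ‖N‖ = ‖hH.eigenvalues‖ := by
    conv_lhs => rw [hspec]
    rw [Unitary.conjStarAlgAut_apply]
    have : (star (hH.eigenvectorUnitary : Matrix I I ℝ)) =
      ((star hH.eigenvectorUnitary : unitaryGroup I ℝ) : Matrix I I ℝ) := rfl
    rw [this, CStarRing.norm_mul_coe_unitary, CStarRing.norm_coe_unitary_mul, l2_opNorm_diagonal]
    rfl
  rw [hsum, hle]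
  have hnn : ∀ i, 0 ≤ hH.eigenvalues i := hN.eigenvalues_nonneg
  -- With no rows the trace vanishes, and the left side does so only because `k ≠ 0`.
  rcases isEmpty_or_nonempty I with hI | hI
  · have : ‖hH.eigenvalues‖ = 0 := by
      rw [norm_eq_zero]
      exact Subsingleton.elim _ _
    simp [this, hk]
  · obtain ⟨i, hi⟩ := Finite.exists_max hH.eigenvalues
    have hmax : ‖hH.eigenvalues‖ ≤ hH.eigenvalues i := by
      refine (pi_norm_le_iff_of_nonneg (hnn i)).2 fun j => ?_
      rw [Real.norm_of_nonneg (hnn j)]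
      exact hi j
    refine (pow_le_pow_left₀ (norm_nonneg _) hmax k).trans ?_
    exact Finset.single_le_sum (f := fun i => hH.eigenvalues i ^ k)
      (fun j _ => pow_nonneg (hnn j) k) (Finset.mem_univ i)

/-- The spectral norm is at most the Frobenius norm. -/
theorem l2_opNorm_sq_le_sum_sq {I J : Type*} [Fintype I] [DecidableEq I] [Fintype J]
    [DecidableEq J] (M : Matrix I J ℝ) : ‖M‖ ^ 2 ≤ ∑ i, ∑ j, M i j ^ 2 := by
  have := l2_opNorm_pow_le_trace M one_ne_zero
  simpa [trace, mul_apply, sq] using this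

end Matrix

/-! ### Counting walks, sequences and left inverses. -/

section Counting

/-- A walk visits at most one vertex more than it has distinct edges. -/
theorem card_image_walk_le {V : Type*} [DecidableEq V] (w : ℕ → V) (m : ℕ) :
    ((Finset.range (m + 1)).image w).card ≤
      ((Finset.range m).image fun r => s(w r, w (r + 1))).card + 1 := by
  induction m with
  | zero => simp
  | succ m ih =>
    rw [Finset.range_add_one (n := m + 1), Finset.image_insert]
    by_cases h : w (m + 1) ∈ (Finset.range (m + 1)).image w
    · rw [Finset.insert_eq_of_mem h]
      exact ih.trans (Nat.add_le_add_right
        (Finset.card_le_card (Finset.image_subset_image (Finset.range_subset_range.2 m.le_succ))) 1)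
    -- Reaching a new vertex uses a new edge, since earlier edges have both ends among earlier
    -- vertices.
    · have hE : ((Finset.range (m + 1)).image fun r => s(w r, w (r + 1))) =
          insert s(w m, w (m + 1)) ((Finset.range m).image fun r => s(w r, w (r + 1))) := by
        rw [Finset.range_add_one, Finset.image_insert]
      rw [Finset.card_insert_of_notMem h, hE, Finset.card_insert_of_notMem]
      · omega
      · intro hmem
        obtain ⟨r, hr, he⟩ := Finset.mem_image.1 hmem
        rw [Finset.mem_range] at hr
        have : w (m + 1) ∈ s(w r, w (r + 1)) := by
          rw [he]
          exact Sym2.mem_mk_right _ _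
        rcases Sym2.mem_iff.1 this with h' | h'
        · exact h (Finset.mem_image.2 ⟨r, by simp; omega, h'.symm⟩)
        · exact h (Finset.mem_image.2 ⟨r + 1, by simp; omega, h'.symm⟩)

/-- A walk alternating between the sequences `p` and `r` visits at most one vertex more than it has
distinct edges. -/
theorem card_image_union_le {V : Type*} [DecidableEq V] {k : ℕ} (p : Fin (k + 1) → V)
    (r : Fin k → V) :
    (Finset.univ.image p ∪ Finset.univ.image r).card ≤
      ((Finset.univ : Finset (Fin k × Bool)).image fun τ =>
        s(p (if τ.2 then τ.1.succ else τ.1.castSucc), r τ.1)).card + 1 := by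
  classical
  -- The interleaving `p 0, r 0, p 1, r 1, …, p k`; values beyond position `2 * k` are never used.
  let w : ℕ → V := fun m =>
    if h : m % 2 = 1 ∧ m / 2 < k then r ⟨m / 2, h.2⟩ else p (Fin.ofNat (k + 1) (m / 2))
  have hp : ∀ s : Fin (k + 1), w (2 * s) = p s := by
    intro s
    have : ¬ ((2 * (s : ℕ)) % 2 = 1 ∧ (2 * (s : ℕ)) / 2 < k) := by omega
    simp only [w, dif_neg this]
    congr 1
    ext
    simp
  have hr : ∀ s : Fin k, w (2 * s + 1) = r s := by
    intro s
    have h2 : (2 * (s : ℕ) + 1) / 2 = s := by omega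
    have : ((2 * (s : ℕ) + 1) % 2 = 1 ∧ (2 * (s : ℕ) + 1) / 2 < k) := by
      have := s.2
      omega
    simp only [w, dif_pos this]
    congr 1
    ext
    exact h2
  refine le_trans (Finset.card_le_card ?_) ((card_image_walk_le w (2 * k)).trans
    (Nat.add_le_add_right (Finset.card_le_card ?_) 1))
  · intro z hz
    simp only [Finset.mem_union, Finset.mem_image, Finset.mem_univ, true_and] at hz
    rcases hz with ⟨s, rfl⟩ | ⟨s, rfl⟩
    · exact Finset.mem_image.2 ⟨2 * s, by simp; omega, hp s⟩
    · exact Finset.mem_image.2 ⟨2 * s + 1, by simp, hr s⟩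
  · intro z hz
    obtain ⟨m, hm, rfl⟩ := Finset.mem_image.1 hz
    rw [Finset.mem_range] at hm
    obtain ⟨s, hs⟩ := Nat.even_or_odd' m
    have hsk : s < k := by omega
    rcases hs with rfl | rfl
    · refine Finset.mem_image.2 ⟨(⟨s, hsk⟩, false), Finset.mem_univ _, ?_⟩
      have h1 := hp (Fin.castSucc ⟨s, hsk⟩)
      have h2 := hr ⟨s, hsk⟩
      simp only [Fin.val_castSucc] at h1 h2
      simp [h1, h2]
    · refine Finset.mem_image.2 ⟨(⟨s, hsk⟩, true), Finset.mem_univ _, ?_⟩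
      have h1 := hp (Fin.succ ⟨s, hsk⟩)
      have h2 := hr ⟨s, hsk⟩
      simp only [Fin.val_succ, mul_add, mul_one] at h1 h2
      simp only [if_true]
      rw [← h1, h2, Sym2.eq_swap, ← h2]

/-- The number of sequences taking few values. -/
theorem card_few_values_le {T V : Type*} [Fintype T] [Nonempty T] [DecidableEq T] [Fintype V]
    [DecidableEq V] (m : ℕ) :
    (Finset.univ.filter fun f : T → V => (Finset.univ.image f).card ≤ m + 1).card ≤
      Fintype.card V ^ (m + 1) * (m + 1) ^ Fintype.card T := by
  classical
  -- A function with at most `m + 1` values factors through `Fin (m + 1)`.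
  have : (Finset.univ.filter fun f : T → V => (Finset.univ.image f).card ≤ m + 1) ⊆
      (Finset.univ : Finset ((Fin (m + 1) → V) × (T → Fin (m + 1)))).image
        fun x => x.1 ∘ x.2 := by
    intro f hf
    have hf' := (Finset.mem_filter.1 hf).2
    have hcard : Fintype.card (Set.range f) ≤ Fintype.card (Fin (m + 1)) := by
      rw [Fintype.card_fin, ← Set.toFinset_card]
      convert hf' using 2
      ext
      simp
    obtain ⟨e⟩ := Function.Embedding.nonempty_of_card_le hcard
    have : Nonempty (Set.range f) := ⟨⟨_, Set.mem_range_self (Classical.arbitrary T)⟩⟩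
    refine Finset.mem_image.2 ⟨(fun i => (Function.invFun e i).1, fun s => e ⟨f s, s, rfl⟩),
      Finset.mem_univ _, ?_⟩
    funext s
    simp [Function.leftInverse_invFun e.injective _]
  refine (Finset.card_le_card this).trans (Finset.card_image_le.trans ?_)
  simp

/-- A map all of whose values are attained an even number of times takes at most half as many
values as there are arguments. -/
theorem two_mul_card_image_le_of_even {T V : Type*} [Fintype T] [DecidableEq V] (f : T → V)
    (h : ∀ a, Even (Finset.univ.filter fun b : T => f b = f a).card) :
    2 * (Finset.univ.image f).card ≤ Fintype.card T := by
  refine Finset.mul_card_image_le_card (Finset.univ : Finset T) 2 ?_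
  intro z hz
  obtain ⟨a, -, rfl⟩ := Finset.mem_image.1 hz
  obtain ⟨c, hc⟩ := h a
  have : 0 < (Finset.univ.filter fun b => f b = f a).card :=
    Finset.card_pos.2 ⟨a, by simp⟩
  omega

/-- The number of left inverses of an injective map, in multiplicative form. -/
theorem card_leftInverse_mul {α β : Type*} [Fintype α] [DecidableEq α] [Fintype β]
    [DecidableEq β] {f : α → β} (hf : Function.Injective f) :
    (Finset.univ.filter fun c : β → α => ∀ a, c (f a) = a).card * Fintype.card α ^ Fintype.card α =
      Fintype.card α ^ Fintype.card β := by
  classical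
  -- The condition decouples over `b`: the value is forced on the range of `f` and free elsewhere.
  have heq : (Finset.univ.filter fun c : β → α => ∀ a, c (f a) = a) =
      Fintype.piFinset fun b => Finset.univ.filter fun z => ∀ a, f a = b → z = a := by
    ext c
    simp only [Finset.mem_filter, Finset.mem_univ, true_and, Fintype.mem_piFinset]
    constructor
    · rintro h b a rfl
      exact h a
    · intro h a
      exact h _ a rfl
  have hval : ∀ b, (Finset.univ.filter fun z : α => ∀ a, f a = b → z = a).card =
      if b ∈ Finset.univ.image f then 1 else Fintype.card α := by
    intro b
    split_ifs with hb
    · obtain ⟨a, -, rfl⟩ := Finset.mem_image.1 hb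
      rw [Finset.card_eq_one]
      refine ⟨a, ?_⟩
      ext z
      simp only [Finset.mem_filter, Finset.mem_univ, true_and, Finset.mem_singleton]
      exact ⟨fun h => h a rfl, fun h a' ha' => h.trans (hf ha').symm⟩
    · rw [Finset.filter_true_of_mem, Finset.card_univ]
      intro z _ a ha
      exact absurd (Finset.mem_image.2 ⟨a, Finset.mem_univ _, ha⟩) hb
  rw [heq, Fintype.card_piFinset, Finset.prod_congr rfl fun b _ => hval b, Finset.prod_ite]
  have h1 : (Finset.univ.filter fun b => b ∉ Finset.univ.image f).card + Fintype.card α =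
      Fintype.card β := by
    have : (Finset.univ.image f).card = Fintype.card α := by
      rw [Finset.card_image_of_injective _ hf, Finset.card_univ]
    rw [← this, Finset.filter_not, Finset.filter_mem_eq_inter, Finset.univ_inter,
      Finset.card_sdiff_add_card_eq_card (Finset.subset_univ _), Finset.card_univ]
  rw [Finset.prod_const_one, one_mul, Finset.prod_const, ← pow_add, h1]

/-- The number of assignments satisfying a binary constraint on each pair of a matching. -/
theorem card_matching_constrained_le {α X : Type*} [Fintype α] [DecidableEq α] [Fintype X]
    [DecidableEq X] {m : ℕ} (p r : Fin m → α) (hpr : Function.Injective (Sum.elim p r))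
    (P : X → X → Prop) [DecidableRel P] :
    (Finset.univ.filter fun F : α → X => ∀ l, P (F (p l)) (F (r l))).card ≤
      (Finset.univ.filter fun z : X × X => P z.1 z.2).card ^ m *
        Fintype.card X ^ (Fintype.card α - 2 * m) := by
  classical
  let S : Finset α := Finset.univ.image (Sum.elim p r)
  have hS : (Sᶜ).card = Fintype.card α - 2 * m := by
    rw [Finset.card_compl, Finset.card_image_of_injective _ hpr]
    simp [two_mul]
  have hcard : Fintype.card ((Fin m → {z : X × X // P z.1 z.2}) × ({a // a ∈ Sᶜ} → X)) =
      (Finset.univ.filter fun z : X × X => P z.1 z.2).card ^ m *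
        Fintype.card X ^ (Fintype.card α - 2 * m) := by
    rw [Fintype.card_prod, Fintype.card_fun, Fintype.card_fun, Fintype.card_fin,
      Fintype.card_subtype, Fintype.card_coe, hS]
  rw [← hcard, ← Fintype.card_subtype]
  refine Fintype.card_le_of_injective
    (fun F => (fun l => ⟨(F.1 (p l), F.1 (r l)), F.2 l⟩, fun a => F.1 a.1)) ?_
  intro F F' h
  obtain ⟨h1, h2⟩ := Prod.mk.inj h
  ext a
  by_cases ha : a ∈ S
  · obtain ⟨l | l, -, rfl⟩ := Finset.mem_image.1 ha
    · exact congrArg (fun z => z.1.1) (congrFun h1 l)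
    · exact congrArg (fun z => z.1.2) (congrFun h1 l)
  · exact congrFun h2 ⟨a, Finset.mem_compl.2 ha⟩

end Counting

/-! ### Kőnig's theorem. -/

namespace SimpleGraph

/-- Hall's condition for one side of a minimum vertex cover. -/
theorem card_le_card_neighbors_of_isVertexCover {α : Type*} [Fintype α] [DecidableEq α]
    {H : SimpleGraph α} [DecidableRel H.Adj] {C : Finset α} (hC : H.IsVertexCover (C : Set α))
    (hmin : ∀ D : Finset α, H.IsVertexCover (D : Set α) → C.card ≤ D.card)
    {S : Finset α} (hSC : S ⊆ C) (hS : ∀ a ∈ S, ∀ b ∈ S, ¬ H.Adj a b) :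
    S.card ≤ ((S.biUnion fun a => H.neighborFinset a) \ C).card := by
  -- Exchanging `S` for its neighbours outside `C` keeps a cover: as `S` is independent, an edge
  -- from `S` into `C` ends in `C \ S`. Minimality then gives the inequality.
  have hcov : H.IsVertexCover
      (((C \ S) ∪ ((S.biUnion fun a => H.neighborFinset a) \ C) : Finset α) : Set α) := by
    have key : ∀ v w, H.Adj v w → v ∈ C →
        v ∈ (C \ S) ∪ ((S.biUnion fun a => H.neighborFinset a) \ C) ∨
        w ∈ (C \ S) ∪ ((S.biUnion fun a => H.neighborFinset a) \ C) := by
      intro v w hvw hv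
      by_cases hvS : v ∈ S
      · right
        by_cases hw : w ∈ C
        · refine Finset.mem_union_left _ (Finset.mem_sdiff.2 ⟨hw, fun hwS => hS v hvS w hwS hvw⟩)
        · refine Finset.mem_union_right _ (Finset.mem_sdiff.2 ⟨Finset.mem_biUnion.2
            ⟨v, hvS, ?_⟩, hw⟩)
          simpa using hvw
      · left
        exact Finset.mem_union_left _ (Finset.mem_sdiff.2 ⟨hv, hvS⟩)
    intro v w hvw
    rcases hC hvw with h | h
    · exact_mod_cast key v w hvw (by exact_mod_cast h)
    · exact_mod_cast (key w v hvw.symm (by exact_mod_cast h)).symm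
  have h1 := (hmin _ hcov).trans (Finset.card_union_le _ _)
  have h2 := Finset.card_sdiff_add_card_eq_card hSC
  omega

/-- **Kőnig's theorem**: a bipartite graph has a matching as large as its minimum vertex cover. -/
theorem IsBipartiteWith.exists_matching_of_vertexCoverNum {α : Type*} [Fintype α]
    {H : SimpleGraph α} {U V : Set α} (hH : H.IsBipartiteWith U V) {q : ℕ}
    (hq : H.vertexCoverNum = (q : ℕ∞)) :
    ∃ p r : Fin q → α, Function.Injective p ∧ Function.Injective r ∧
      ∀ l, p l ∈ U ∧ r l ∈ V ∧ H.Adj (p l) (r l) := by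
  classical
  obtain ⟨C', hC'card, hC'⟩ := vertexCoverNum_exists H
  obtain ⟨C, rfl⟩ : ∃ C : Finset α, (C : Set α) = C' := ⟨C'.toFinset, by simp⟩
  have hCq : C.card = q := by
    rw [hq, Set.encard_coe_eq_coe_finsetCard] at hC'card
    exact_mod_cast hC'card
  have hmin : ∀ D : Finset α, H.IsVertexCover (D : Set α) → C.card ≤ D.card := by
    intro D hD
    have := hD.vertexCoverNum_le
    rw [hq, Set.encard_coe_eq_coe_finsetCard] at this
    rw [hCq]
    exact_mod_cast this
  have hdisj := Set.disjoint_left.1 hH.disjoint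
  have hUU : ∀ a b, a ∈ U → H.Adj a b → b ∈ V := fun a b ha hab =>
    hH.mem_of_mem_adj ha hab
  have hVV : ∀ a b, a ∈ V → H.Adj a b → b ∈ U := fun a b ha hab =>
    hH.symm.mem_of_mem_adj ha hab
  have hmem : ∀ a b, H.Adj a b → a ∈ U ∨ a ∈ V := fun a b hab =>
    (hH.mem_of_adj hab).imp And.left And.left
  have hCUV : ∀ a ∈ C, a ∈ U ∨ a ∈ V := by
    intro a ha
    by_contra hcon
    have hlt : (C.erase a).card < C.card := Finset.card_erase_lt_of_mem ha
    refine absurd (hmin (C.erase a) ?_) (not_le.2 hlt)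
    intro v w hvw
    have h1 : v ≠ a := fun h => hcon (h ▸ hmem v w hvw)
    have h2 : w ≠ a := fun h => hcon (h ▸ hmem w v hvw.symm)
    simpa [h1, h2] using hC' hvw
  let N : {a // a ∈ C} → Finset α := fun a => H.neighborFinset a.1 \ C
  -- Hall's condition for both sides at once: the parts of `S` in `U` and in `V` have their
  -- neighbours on opposite sides, so the two estimates add.
  obtain ⟨m, hm, hmN⟩ := (Finset.all_card_le_biUnion_card_iff_exists_injective N).1 (by
    intro S
    let T : Finset α := S.map (Function.Embedding.subtype _)
    have hTC : T ⊆ C := by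
      intro a ha
      obtain ⟨b, -, rfl⟩ := Finset.mem_map.1 ha
      exact b.2
    have hTU := card_le_card_neighbors_of_isVertexCover hC' hmin
      (S := T.filter (· ∈ U)) ((Finset.filter_subset _ _).trans hTC)
      (fun a ha b hb hab => hdisj (Finset.mem_filter.1 hb).2
        (hUU a b (Finset.mem_filter.1 ha).2 hab))
    have hTV := card_le_card_neighbors_of_isVertexCover hC' hmin
      (S := T.filter (· ∉ U)) ((Finset.filter_subset _ _).trans hTC) (by
        intro a ha b hb hab
        have haV := (hCUV a (hTC (Finset.mem_filter.1 ha).1)).resolve_left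
          (Finset.mem_filter.1 ha).2
        exact (Finset.mem_filter.1 hb).2 (hVV a b haV hab))
    have hcard : S.card = (T.filter (· ∈ U)).card + (T.filter (· ∉ U)).card := by
      rw [Finset.card_filter_add_card_filter_not, Finset.card_map]
    rw [hcard]
    refine (Nat.add_le_add hTU hTV).trans ?_
    rw [← Finset.card_union_of_disjoint]
    · refine Finset.card_le_card ?_
      intro z hz
      have : ∃ a ∈ T, H.Adj a z ∧ z ∉ C := by
        simp only [Finset.mem_union, Finset.mem_sdiff, Finset.mem_biUnion, Finset.mem_filter,
          mem_neighborFinset] at hz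
        rcases hz with ⟨⟨a, ⟨ha, -⟩, haz⟩, hzC⟩ | ⟨⟨a, ⟨ha, -⟩, haz⟩, hzC⟩ <;>
          exact ⟨a, ha, haz, hzC⟩
      obtain ⟨a, ha, haz, hzC⟩ := this
      obtain ⟨b, hb, rfl⟩ := Finset.mem_map.1 ha
      exact Finset.mem_biUnion.2 ⟨b, hb, Finset.mem_sdiff.2 ⟨by simpa using haz, hzC⟩⟩
    · rw [Finset.disjoint_left]
      intro z hz hz'
      simp only [Finset.mem_sdiff, Finset.mem_biUnion, Finset.mem_filter,
        mem_neighborFinset] at hz hz'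
      obtain ⟨⟨a, ⟨ha, haU⟩, haz⟩, -⟩ := hz
      obtain ⟨⟨b, ⟨hb, hbU⟩, hbz⟩, -⟩ := hz'
      have hbV := (hCUV b (hTC hb)).resolve_left hbU
      exact hdisj (hVV b z hbV hbz) (hUU a z haU haz))
  have hadj : ∀ a, H.Adj a.1 (m a) := fun a => by
    simpa using (Finset.mem_sdiff.1 (hmN a)).1
  have hnot : ∀ a, m a ∉ C := fun a => (Finset.mem_sdiff.1 (hmN a)).2
  let ε : Fin q ≃ {a // a ∈ C} := (Finset.equivFinOfCardEq hCq).symm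
  -- Since `m` maps `C` injectively outside `C`, any choice of one end from each pair is injective;
  -- `W = U` selects the ends in `U`, `W = Uᶜ` the others.
  have hinj : ∀ W : Set α, Function.Injective fun l =>
      if (ε l).1 ∈ W then (ε l).1 else m (ε l) := by
    intro W l l' h
    simp only at h
    apply ε.injective
    split_ifs at h with h1 h2 h2
    · exact Subtype.ext h
    · exact absurd (h ▸ (ε l).2) (hnot (ε l'))
    · exact absurd (h ▸ (ε l').2) (hnot (ε l))
    · exact hm h
  refine ⟨_, _, hinj U, hinj Uᶜ, fun l => ?_⟩
  by_cases h : (ε l).1 ∈ U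
  · simpa [h] using ⟨hUU _ _ h (hadj _), hadj _⟩
  · have hV := (hCUV _ (ε l).2).resolve_left h
    simpa [h] using ⟨hVV _ _ hV (hadj _), hV, (hadj _).symm⟩

end SimpleGraph

/-! ### Edge variables and the uniform law. -/

namespace GraphMatrix

theorem abs_edgeVar {n : ℕ} (G : SimpleGraph (Fin n)) (e : Sym2 (Fin n)) : |edgeVar G e| = 1 := by
  unfold edgeVar
  split_ifs <;> simp

/-- Adding or removing the edge `e` flips the edge variable of `e` and no other. -/
theorem edgeVar_symmDiff {n : ℕ} (G : SimpleGraph (Fin n)) {e : Sym2 (Fin n)} (he : ¬ e.IsDiag)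
    (e' : Sym2 (Fin n)) :
    edgeVar (symmDiff G (SimpleGraph.fromEdgeSet {e})) e' =
      (if e' = e then -1 else 1) * edgeVar G e' := by
  have hmem : e' ∈ (symmDiff G (SimpleGraph.fromEdgeSet {e})).edgeSet ↔
      (e' ∈ G.edgeSet ∧ e' ≠ e) ∨ (e' = e ∧ e' ∉ G.edgeSet) := by
    rw [symmDiff_def, SimpleGraph.edgeSet_sup, SimpleGraph.edgeSet_sdiff,
      SimpleGraph.edgeSet_sdiff, SimpleGraph.edgeSet_fromEdgeSet]
    have : ({e} \ Sym2.diagSet : Set (Sym2 (Fin n))) = {e} := by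
      ext z
      simp only [Set.mem_sdiff, Set.mem_singleton_iff, Sym2.mem_diagSet]
      exact ⟨And.left, fun h => ⟨h, h ▸ he⟩⟩
    rw [this]
    simp
  unfold edgeVar
  by_cases h1 : e' = e <;> by_cases h2 : e' ∈ G.edgeSet <;> simp [hmem, h1, h2] <;>
    simp_all

/-- A product of edge variables with nonzero mean uses every edge an even number of times. -/
theorem even_card_of_sum_prod_edgeVar_ne_zero {n : ℕ} {T : Type*} (S : Finset T)
    (e : T → Sym2 (Fin n)) (h : ∑ G : SimpleGraph (Fin n), ∏ τ ∈ S, edgeVar G (e τ) ≠ 0)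
    {z : Sym2 (Fin n)} (hz : ¬ z.IsDiag) : Even (S.filter fun τ => e τ = z).card := by
  classical
  by_contra hodd
  rw [Nat.not_even_iff_odd] at hodd
  apply h
  -- Toggling `z` permutes the graphs and, `z` occurring an odd number of times, negates the
  -- product; the sum is its own negative.
  have hinv : Function.Involutive fun G : SimpleGraph (Fin n) =>
      symmDiff G (SimpleGraph.fromEdgeSet {z}) := fun G => symmDiff_symmDiff_cancel_right _ _
  have hsum := Equiv.sum_comp (hinv.toPerm _)
    (fun G : SimpleGraph (Fin n) => ∏ τ ∈ S, edgeVar G (e τ))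
  have hflip : ∀ G : SimpleGraph (Fin n), ∏ τ ∈ S, edgeVar (hinv.toPerm _ G) (e τ) =
      -∏ τ ∈ S, edgeVar G (e τ) := by
    intro G
    simp only [Function.Involutive.coe_toPerm, edgeVar_symmDiff G hz]
    rw [Finset.prod_mul_distrib, Finset.prod_ite, Finset.prod_const, Finset.prod_const_one,
      hodd.neg_one_pow]
    ring
  simp only [hflip, Finset.sum_neg_distrib] at hsum
  linarith

instance {n : ℕ} : MeasurableSingletonClass (SimpleGraph (Fin n)) where
  measurableSet_singleton G := by
    have : ({G} : Set (SimpleGraph (Fin n))) = SimpleGraph.edgeSet ⁻¹' {G.edgeSet} := by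
      ext G'
      simp
    rw [this]
    exact SimpleGraph.measurable_edgeSet (measurableSet_singleton _)

/-- At probability `1 / 2` edges and non-edges weigh the same, so all graphs have equal mass; total
mass `1` then fixes it without counting graphs. -/
theorem gnHalf_singleton {n : ℕ} (G : SimpleGraph (Fin n)) :
    gnHalf n {G} = (Fintype.card (SimpleGraph (Fin n)) : ENNReal)⁻¹ := by
  have hconst : ∀ G G' : SimpleGraph (Fin n), gnHalf n {G} = gnHalf n {G'} := by
    have hhalf : ∀ G : SimpleGraph (Fin n), gnHalf n {G} = (2⁻¹ : ENNReal) ^ n.choose 2 := by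
      intro G
      have hσ : unitInterval.symm ⟨1 / 2, by norm_num, by norm_num⟩ =
          (⟨1 / 2, by norm_num, by norm_num⟩ : unitInterval) := by
        ext
        norm_num
      have hle : G.edgeSet.ncard ≤ n.choose 2 := by
        classical
        have := G.card_edgeFinset_le_card_choose_two
        rwa [Fintype.card_fin, ← SimpleGraph.coe_edgeFinset, Set.ncard_coe_finset] at *
      have hval : ((unitInterval.toNNReal ⟨1 / 2, by norm_num, by norm_num⟩ : NNReal) : ENNReal) =
          2⁻¹ := by
        rw [show (unitInterval.toNNReal ⟨1 / 2, by norm_num, by norm_num⟩ : NNReal) = 2⁻¹ by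
          ext; simp]
        simp
      rw [gnHalf, SimpleGraph.binomialRandom_singleton, hσ, hval, ← pow_add,
        Nat.card_eq_fintype_card, Fintype.card_fin, Nat.add_sub_cancel' hle]
    intro G G'
    rw [hhalf, hhalf]
  have hprob : gnHalf n Set.univ = 1 := by
    unfold gnHalf
    exact MeasureTheory.measure_univ
  have hsum : ∑ G' : SimpleGraph (Fin n), gnHalf n {G'} = 1 := by
    rw [MeasureTheory.sum_measure_singleton, Finset.coe_univ, hprob]
  rw [Finset.sum_congr rfl fun G' _ => hconst G' G, Finset.sum_const, nsmul_eq_mul,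
    Finset.card_univ] at hsum
  exact ENNReal.eq_inv_of_mul_eq_one_left (by rwa [mul_comm])

/-- `G(n, 1/2)` is the uniform distribution on graphs. -/
theorem gnHalf_apply {n : ℕ} (S : Finset (SimpleGraph (Fin n))) :
    gnHalf n (S : Set (SimpleGraph (Fin n))) =
      ENNReal.ofReal (S.card / Fintype.card (SimpleGraph (Fin n))) := by
  rw [← MeasureTheory.sum_measure_singleton, Finset.sum_congr rfl fun G _ => gnHalf_singleton G,
    Finset.sum_const, nsmul_eq_mul, ENNReal.ofReal_div_of_pos (by exact_mod_cast Fintype.card_pos),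
    ENNReal.ofReal_natCast, ENNReal.ofReal_natCast, div_eq_mul_inv]

/-! ### Colour-restricted graph matrices. -/

section Bipartite

variable {α : Type*} {x y n : ℕ}

/-- The map of the vertices of `H` determined by the images of its two sides. -/
def glue {β : Type*} (e : Fin x ⊕ Fin y ≃ α) (A : Fin x → β) (B : Fin y → β) : α → β :=
  Sum.elim A B ∘ e.symm

@[simp]
theorem glue_inl {β : Type*} (e : Fin x ⊕ Fin y ≃ α) (A : Fin x → β) (B : Fin y → β) (i : Fin x) :
    glue e A B (e (Sum.inl i)) = A i := by
  simp [glue]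

@[simp]
theorem glue_inr {β : Type*} (e : Fin x ⊕ Fin y ≃ α) (A : Fin x → β) (B : Fin y → β) (j : Fin y) :
    glue e A B (e (Sum.inr j)) = B j := by
  simp [glue]

theorem eq_glue_iff {β : Type*} (e : Fin x ⊕ Fin y ≃ α) (A : Fin x → β) (B : Fin y → β)
    (π : α → β) :
    ((∀ i, π (e (Sum.inl i)) = A i) ∧ ∀ j, π (e (Sum.inr j)) = B j) ↔ π = glue e A B := by
  constructor
  · rintro ⟨hA, hB⟩
    funext a
    obtain ⟨z, rfl⟩ := e.surjective a
    cases z <;> simp [hA, hB]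
  · rintro rfl
    simp

theorem KSubset.list_injective {k : ℕ} : Function.Injective (KSubset.list : KSubset n k → _) := by
  intro A B h
  have hA := Finset.range_orderEmbOfFin A.1 A.2
  have hB := Finset.range_orderEmbOfFin B.1 B.2
  apply Subtype.ext
  rw [← Finset.coe_inj, ← hA, ← hB]
  exact congrArg Set.range h

variable [Fintype α]

open Classical in
/-- The part of the graph matrix supported on the images of `H` on which `c` is inverse to the
embedding. -/
noncomputable def coloredR (H : SimpleGraph α) (e : Fin x ⊕ Fin y ≃ α) (c : Fin n → α)
    (G : SimpleGraph (Fin n)) : Matrix (KSubset n x) (KSubset n y) ℝ :=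
  Matrix.of fun A B => if ∀ a, c (glue e A.list B.list a) = a then
    ∏ h ∈ H.edgeFinset, edgeVar G (h.map (glue e A.list B.list)) else 0

-- The two sides exhaust the vertices of `H`, so the sum over embeddings has one term or none.
open Classical in
theorem R_apply (H : SimpleGraph α) (e : Fin x ⊕ Fin y ≃ α) (u : Fin x ↪ α) (v : Fin y ↪ α)
    (hu : ∀ i, u i = e (Sum.inl i)) (hv : ∀ j, v j = e (Sum.inr j)) (G : SimpleGraph (Fin n))
    (A : KSubset n x) (B : KSubset n y) :
    R H u v G A B = if Function.Injective (glue e A.list B.list) then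
      ∏ h ∈ H.edgeFinset, edgeVar G (h.map (glue e A.list B.list)) else 0 := by
  simp only [R, Matrix.of_apply, hu, hv, eq_glue_iff]
  split_ifs with hinj
  · have : (Finset.univ.filter fun π : α ↪ Fin n => (π : α → Fin n) = glue e A.list B.list) =
        {⟨glue e A.list B.list, hinj⟩} := by
      ext π
      simp [DFunLike.ext'_iff]
    rw [this, Finset.sum_singleton, chi, Finset.prod_map]
    rfl
  · rw [Finset.filter_false_of_mem, Finset.sum_empty]
    intro π _ hπ
    exact hinj (hπ ▸ π.injective)

/-- With `t` vertices in `H`, each embedding has `t ^ (n - t)` left inverses among the `t ^ n`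
colourings. Multiplying by `t ^ t` avoids the subtraction. -/
theorem sum_coloredR (H : SimpleGraph α) (e : Fin x ⊕ Fin y ≃ α) (u : Fin x ↪ α) (v : Fin y ↪ α)
    (hu : ∀ i, u i = e (Sum.inl i)) (hv : ∀ j, v j = e (Sum.inr j)) (G : SimpleGraph (Fin n)) :
    ((Fintype.card α : ℝ) ^ Fintype.card α) • ∑ c : Fin n → α, coloredR H e c G =
      ((Fintype.card α : ℝ) ^ n) • R H u v G := by
  classical
  ext A B
  rw [Matrix.smul_apply, Matrix.smul_apply, Matrix.sum_apply, R_apply H e u v hu hv]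
  simp only [coloredR, Matrix.of_apply, smul_eq_mul]
  by_cases hinj : Function.Injective (glue e A.list B.list)
  · rw [if_pos hinj, ← Finset.sum_filter, Finset.sum_const, nsmul_eq_mul, ← mul_assoc]
    congr 1
    have := card_leftInverse_mul hinj
    rw [Fintype.card_fin] at this
    rw [mul_comm]
    convert congrArg (Nat.cast (R := ℝ)) this using 1 <;> push_cast <;> congr!
  · rw [if_neg hinj, mul_zero, Finset.sum_eq_zero, mul_zero]
    intro c _
    rw [if_neg]
    intro hc
    exact hinj (Function.LeftInverse.injective (g := c) hc)

theorem abs_coloredR_le (H : SimpleGraph α) (e : Fin x ⊕ Fin y ≃ α) (c : Fin n → α)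
    (G : SimpleGraph (Fin n)) (A : KSubset n x) (B : KSubset n y) :
    |coloredR H e c G A B| ≤ 1 := by
  classical
  simp only [coloredR, Matrix.of_apply]
  split_ifs
  · rw [Finset.abs_prod, Finset.prod_congr rfl fun h _ => abs_edgeVar G _]
    simp
  · simp

theorem abs_R_le (H : SimpleGraph α) (e : Fin x ⊕ Fin y ≃ α) (u : Fin x ↪ α) (v : Fin y ↪ α)
    (hu : ∀ i, u i = e (Sum.inl i)) (hv : ∀ j, v j = e (Sum.inr j)) (G : SimpleGraph (Fin n))
    (A : KSubset n x) (B : KSubset n y) : |R H u v G A B| ≤ 1 := by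
  classical
  rw [R_apply H e u v hu hv]
  split_ifs
  · rw [Finset.abs_prod, Finset.prod_congr rfl fun h _ => abs_edgeVar G _]
    simp
  · simp

/-- A closed walk contributing to the mean trace visits few vertices along each edge of `H`. -/
theorem card_image_le_of_sum_ne_zero (H : SimpleGraph α) (e : Fin x ⊕ Fin y ≃ α) (c : Fin n → α)
    {k : ℕ} (f : Fin (k + 1) → KSubset n x) (b : Fin k → KSubset n y)
    (hne : ∑ G : SimpleGraph (Fin n), ∏ s : Fin k,
      coloredR H e c G (f s.castSucc) (b s) * coloredR H e c G (f s.succ) (b s) ≠ 0)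
    {i : Fin x} {j : Fin y} (hij : H.Adj (e (Sum.inl i)) (e (Sum.inr j))) :
    (Finset.univ.image (fun s => (f s).list i) ∪ Finset.univ.image fun s => (b s).list j).card ≤
      k + 1 := by
  classical
  -- The `2k` placements of `H` along the walk; the Boolean tells whether `b s` is joined to the
  -- next or the previous row set.
  let g : Fin k × Bool → α → Fin n := fun τ =>
    glue e (f (if τ.2 then τ.1.succ else τ.1.castSucc)).list (b τ.1).list
  have hprod : ∀ G : SimpleGraph (Fin n), (∏ s : Fin k,
      coloredR H e c G (f s.castSucc) (b s) * coloredR H e c G (f s.succ) (b s)) =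
      ∏ τ : Fin k × Bool, if ∀ a, c (g τ a) = a then
        ∏ h ∈ H.edgeFinset, edgeVar G (h.map (g τ)) else 0 := by
    intro G
    rw [Fintype.prod_prod_type]
    refine Finset.prod_congr rfl fun s _ => ?_
    rw [Fintype.prod_bool, mul_comm]
    simp only [coloredR, Matrix.of_apply, g, if_true, Bool.false_eq_true, if_false]
  have hc : ∀ τ a, c (g τ a) = a := by
    by_contra hcon
    push Not at hcon
    obtain ⟨τ, a, ha⟩ := hcon
    apply hne
    refine Finset.sum_eq_zero fun G _ => ?_
    rw [hprod]
    exact Finset.prod_eq_zero (Finset.mem_univ τ) (if_neg fun h => ha (h a))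
  have hinj : ∀ τ, Function.Injective (g τ) := fun τ => Function.LeftInverse.injective (hc τ)
  have hne' : ∑ G : SimpleGraph (Fin n),
      ∏ z ∈ (Finset.univ : Finset (Fin k × Bool)) ×ˢ H.edgeFinset, edgeVar G (z.2.map (g z.1)) ≠ 0 := by
    convert hne using 2 with G
    rw [hprod, Finset.prod_product]
    refine Finset.prod_congr rfl fun τ _ => ?_
    rw [if_pos (hc τ)]
  let h₀ : Sym2 α := s(e (Sum.inl i), e (Sum.inr j))
  have hh₀ : h₀ ∈ H.edgeFinset := by simpa [h₀] using hij
  have heven : ∀ τ₀ : Fin k × Bool,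
      Even (Finset.univ.filter fun τ => h₀.map (g τ) = h₀.map (g τ₀)).card := by
    intro τ₀
    have hdiag : ¬ (h₀.map (g τ₀)).IsDiag := by
      simp only [h₀, Sym2.map_mk, Sym2.mk_isDiag_iff]
      exact fun h => hij.ne (hinj τ₀ h)
    have := even_card_of_sum_prod_edgeVar_ne_zero _ _ hne' hdiag
    convert this using 1
    refine Finset.card_bij (fun τ _ => (τ, h₀)) ?_ ?_ ?_
    · intro τ hτ
      simp only [Finset.mem_filter, Finset.mem_product, Finset.mem_univ, true_and] at hτ ⊢
      exact ⟨hh₀, hτ⟩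
    · intro τ _ τ' _ h
      exact (Prod.mk.inj h).1
    · rintro ⟨τ, h⟩ hz
      simp only [Finset.mem_filter, Finset.mem_product, Finset.mem_univ, true_and] at hz
      -- Applying `c` to the common image recovers the edge of `H`, so only copies of `h₀` can cover
      -- it and parity holds for `h₀` alone.
      have hh : h = h₀ := by
        have := congrArg (Sym2.map c) hz.2
        simp only [Sym2.map_map] at this
        rwa [show c ∘ g τ = id from funext (hc τ), show c ∘ g τ₀ = id from funext (hc τ₀),
          Sym2.map_id, id, id] at this
      subst hh
      exact ⟨τ, by simpa using hz.2, rfl⟩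
  have h1 := two_mul_card_image_le_of_even _ heven
  rw [Fintype.card_prod, Fintype.card_fin, Fintype.card_bool] at h1
  have h2 := card_image_union_le (fun s => (f s).list i) fun s => (b s).list j
  refine h2.trans (Nat.add_le_add_right ?_ 1)
  have h3 : (fun τ : Fin k × Bool => s((f (if τ.2 then τ.1.succ else τ.1.castSucc)).list i,
      (b τ.1).list j)) = fun τ => h₀.map (g τ) := by
    funext τ
    simp [h₀, g]
  rw [h3]
  omega

end Bipartite

end GraphMatrix

/-! ### Closed walk counts and the moment bound. -/

namespace GraphMatrix

section Moment

variable {α : Type*} [Fintype α] {x y n : ℕ}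

/-- The number of closed walks that can contribute to the mean trace. -/
theorem card_closedWalks_le (e : Fin x ⊕ Fin y ≃ α) {q k : ℕ} (hk : k ≠ 0) (p : Fin q → Fin x)
    (r : Fin q → Fin y) (hp : Function.Injective p) (hr : Function.Injective r) :
    (Finset.univ.filter fun w : (Fin (k + 1) → KSubset n x) × (Fin k → KSubset n y) =>
      w.1 0 = w.1 (Fin.last k) ∧ ∀ l, (Finset.univ.image (fun s => (w.1 s).list (p l)) ∪
        Finset.univ.image fun s => (w.2 s).list (r l)).card ≤ k + 1).card ≤
    (n ^ (k + 1) * (k + 1) ^ (2 * k)) ^ q * (n ^ k) ^ (Fintype.card α - 2 * q) := by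
  classical
  let P : (Fin k → Fin n) → (Fin k → Fin n) → Prop := fun z z' =>
    (Finset.univ.image (Sum.elim z z')).card ≤ k + 1
  have hpr : Function.Injective
      (Sum.elim (fun l => e (Sum.inl (p l))) fun l => e (Sum.inr (r l))) := by
    rintro (l | l) (l' | l') h
    · simpa using hp (by simpa using h)
    · simp at h
    · simp at h
    · simpa using hr (by simpa using h)
  have hcount := card_matching_constrained_le _ _ hpr P
  have hgood : (Finset.univ.filter fun z : (Fin k → Fin n) × (Fin k → Fin n) => P z.1 z.2).card ≤
      n ^ (k + 1) * (k + 1) ^ (2 * k) := by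
    have : Nonempty (Fin k) := ⟨⟨0, Nat.pos_of_ne_zero hk⟩⟩
    have h := card_few_values_le (T := Fin k ⊕ Fin k) (V := Fin n) k
    rw [Fintype.card_sum, Fintype.card_fin, Fintype.card_fin, ← two_mul] at h
    refine le_trans (Finset.card_le_card_of_injOn (fun z => Sum.elim z.1 z.2) ?_ ?_) h
    · intro z hz
      simpa [P] using hz
    · rintro ⟨z, z'⟩ - ⟨w, w'⟩ - h
      exact Prod.ext (funext fun s => congrFun h (Sum.inl s))
        (funext fun s => congrFun h (Sum.inr s))
  have hX : Fintype.card (Fin k → Fin n) = n ^ k := by simp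
  rw [hX] at hcount
  refine le_trans ?_ (hcount.trans (Nat.mul_le_mul_right _ (Nat.pow_le_pow_left hgood q)))
  -- A walk becomes one length-`k` trajectory per vertex of `H`; the last row set is dropped, as
  -- closedness restores it.
  refine Finset.card_le_card_of_injOn
    (fun w a s => glue e (w.1 s.castSucc).list (w.2 s).list a) ?_ ?_
  · intro w hw
    simp only [Finset.coe_filter, Finset.mem_univ, true_and, Set.mem_ofPred_eq, P, glue_inl,
      glue_inr] at hw ⊢
    intro l
    refine le_trans (Finset.card_le_card ?_) (hw.2 l)
    intro z hz
    obtain ⟨s | s, -, rfl⟩ := Finset.mem_image.1 hz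
    · exact Finset.mem_union_left _ (Finset.mem_image.2 ⟨s.castSucc, Finset.mem_univ _, rfl⟩)
    · exact Finset.mem_union_right _ (Finset.mem_image.2 ⟨s, Finset.mem_univ _, rfl⟩)
  · rintro ⟨f, b⟩ hw ⟨f', b'⟩ hw' h
    simp only [Finset.coe_filter, Finset.mem_univ, true_and, Set.mem_ofPred_eq] at hw hw'
    have hf : ∀ s : Fin k, f s.castSucc = f' s.castSucc := fun s =>
      KSubset.list_injective (funext fun i => by
        simpa using congrFun (congrFun h (e (Sum.inl i))) s)
    have hb : ∀ s : Fin k, b s = b' s := fun s =>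
      KSubset.list_injective (funext fun j => by
        simpa using congrFun (congrFun h (e (Sum.inr j))) s)
    have h0 : f 0 = f' 0 := hf ⟨0, Nat.pos_of_ne_zero hk⟩
    refine Prod.ext (funext fun s => ?_) (funext hb)
    induction s using Fin.lastCases with
    | last => exact hw.1.symm.trans (h0.trans hw'.1)
    | cast s => exact hf s

/-- Closed walks violating the vertex bound on some matching edge sum to zero over `G`; the others
contribute at most `1` per graph. -/
theorem sum_trace_coloredR_le (H : SimpleGraph α) (e : Fin x ⊕ Fin y ≃ α) (c : Fin n → α)
    {q k : ℕ} (hk : k ≠ 0) (p : Fin q → Fin x) (r : Fin q → Fin y) (hp : Function.Injective p)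
    (hr : Function.Injective r) (hadj : ∀ l, H.Adj (e (Sum.inl (p l))) (e (Sum.inr (r l)))) :
    ∑ G : SimpleGraph (Fin n), ((coloredR H e c G * (coloredR H e c G).transpose) ^ k).trace ≤
      Fintype.card (SimpleGraph (Fin n)) *
        (((n : ℝ) ^ (k + 1) * (k + 1) ^ (2 * k)) ^ q * (n ^ k) ^ (Fintype.card α - 2 * q)) := by
  classical
  simp only [Matrix.trace_mul_transpose_pow]
  rw [Finset.sum_comm]
  have hD : (0 : ℝ) ≤ Fintype.card (SimpleGraph (Fin n)) := Nat.cast_nonneg _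
  let W := Finset.univ.filter fun w : (Fin (k + 1) → KSubset n x) × (Fin k → KSubset n y) =>
      w.1 0 = w.1 (Fin.last k) ∧ ∀ l, (Finset.univ.image (fun s => (w.1 s).list (p l)) ∪
        Finset.univ.image fun s => (w.2 s).list (r l)).card ≤ k + 1
  have hterm : ∀ w : (Fin (k + 1) → KSubset n x) × (Fin k → KSubset n y),
      (∑ G : SimpleGraph (Fin n), if w.1 0 = w.1 (Fin.last k) then
        ∏ s : Fin k, coloredR H e c G (w.1 s.castSucc) (w.2 s) *
          coloredR H e c G (w.1 s.succ) (w.2 s) else 0) ≤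
      if w ∈ W then (Fintype.card (SimpleGraph (Fin n)) : ℝ) else 0 := by
    intro w
    by_cases hw0 : w.1 0 = w.1 (Fin.last k)
    · simp only [if_pos hw0]
      by_cases hw : w ∈ W
      · rw [if_pos hw]
        calc _ ≤ ∑ G : SimpleGraph (Fin n), (1 : ℝ) := by
              refine Finset.sum_le_sum fun G _ => (le_abs_self _).trans ?_
              rw [Finset.abs_prod]
              refine Finset.prod_le_one (fun s _ => abs_nonneg _) fun s _ => ?_
              rw [abs_mul]
              exact mul_le_one₀ (abs_coloredR_le ..) (abs_nonneg _) (abs_coloredR_le ..)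
          _ = _ := by simp
      · rw [if_neg hw]
        refine le_of_eq (by_contra fun hne => hw ?_)
        exact Finset.mem_filter.2 ⟨Finset.mem_univ _, hw0, fun l =>
          card_image_le_of_sum_ne_zero H e c w.1 w.2 hne (hadj l)⟩
    · simp only [if_neg hw0, Finset.sum_const_zero]
      split_ifs
      · exact hD
      · exact le_rfl
  refine (Finset.sum_le_sum fun w _ => hterm w).trans ?_
  rw [Finset.sum_ite_mem, Finset.univ_inter, Finset.sum_const, nsmul_eq_mul, mul_comm]
  refine mul_le_mul_of_nonneg_left ?_ hD
  exact_mod_cast card_closedWalks_le e hk p r hp hr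

/-- The moment bound for the norm of the graph matrix. -/
theorem sum_norm_R_pow_le [Nonempty α] (H : SimpleGraph α) (e : Fin x ⊕ Fin y ≃ α)
    (u : Fin x ↪ α) (v : Fin y ↪ α) (hu : ∀ i, u i = e (Sum.inl i))
    (hv : ∀ j, v j = e (Sum.inr j))
    {q k : ℕ} (hk : k ≠ 0) (p : Fin q → Fin x) (r : Fin q → Fin y) (hp : Function.Injective p)
    (hr : Function.Injective r) (hadj : ∀ l, H.Adj (e (Sum.inl (p l))) (e (Sum.inr (r l)))) :
    ∑ G : SimpleGraph (Fin n), ‖R H u v G‖ ^ (2 * k) ≤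
      ((Fintype.card α : ℝ) ^ Fintype.card α) ^ (2 * k) * (Fintype.card (SimpleGraph (Fin n)) *
        (((n : ℝ) ^ (k + 1) * (k + 1) ^ (2 * k)) ^ q * (n ^ k) ^ (Fintype.card α - 2 * q))) := by
  classical
  set B := (Fintype.card (SimpleGraph (Fin n)) *
        (((n : ℝ) ^ (k + 1) * (k + 1) ^ (2 * k)) ^ q * (n ^ k) ^ (Fintype.card α - 2 * q)))
  set t := Fintype.card α with ht
  have htpos : (0 : ℝ) < t := by
    rw [ht]
    exact_mod_cast Fintype.card_pos
  have hcard : ((Finset.univ : Finset (Fin n → α)).card : ℝ) = (t : ℝ) ^ n := by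
    simp [ht]
  set T := (t : ℝ) ^ n with hT
  have hTpos : 0 < T := pow_pos htpos n
  obtain ⟨m, hm⟩ : ∃ m, 2 * k = m + 1 := ⟨2 * k - 1, by omega⟩
  have hG : ∀ G : SimpleGraph (Fin n), T ^ (2 * k) * ‖R H u v G‖ ^ (2 * k) ≤
      ((t : ℝ) ^ t) ^ (2 * k) * (T ^ m * ∑ c : Fin n → α,
        ((coloredR H e c G * (coloredR H e c G).transpose) ^ k).trace) := by
    intro G
    have hnorm : T * ‖R H u v G‖ ≤ (t : ℝ) ^ t * ∑ c : Fin n → α, ‖coloredR H e c G‖ := by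
      have h := congrArg norm (sum_coloredR H e u v hu hv G)
      rw [norm_smul, norm_smul, Real.norm_of_nonneg (by positivity),
        Real.norm_of_nonneg (by positivity)] at h
      rw [hT, ← h]
      exact mul_le_mul_of_nonneg_left (norm_sum_le _ _) (by positivity)
    rw [← mul_pow]
    refine (pow_le_pow_left₀ (by positivity) hnorm _).trans ?_
    rw [mul_pow]
    refine mul_le_mul_of_nonneg_left ?_ (by positivity)
    -- Power mean inequality over the colourings, with exponent `m + 1 = 2 * k`.
    have hpm := pow_sum_div_card_le_sum_pow (s := (Finset.univ : Finset (Fin n → α)))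
      (f := fun c => ‖coloredR H e c G‖) (fun c _ => norm_nonneg _) m
    rw [hcard, div_le_iff₀ (by positivity), ← hm, mul_comm _ (T ^ m)] at hpm
    refine hpm.trans (mul_le_mul_of_nonneg_left ?_ (by positivity))
    exact Finset.sum_le_sum fun c _ => Matrix.l2_opNorm_pow_le_trace _ hk
  have hsum : T ^ (2 * k) * ∑ G : SimpleGraph (Fin n), ‖R H u v G‖ ^ (2 * k) ≤
      T ^ (2 * k) * (((t : ℝ) ^ t) ^ (2 * k) * B) := by
    rw [Finset.mul_sum]
    refine (Finset.sum_le_sum fun G _ => hG G).trans ?_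
    rw [← Finset.mul_sum, ← Finset.mul_sum, Finset.sum_comm]
    have : ∑ c : Fin n → α, ∑ G : SimpleGraph (Fin n),
        ((coloredR H e c G * (coloredR H e c G).transpose) ^ k).trace ≤ T * B := by
      refine (Finset.sum_le_sum fun c _ => sum_trace_coloredR_le H e c hk p r hp hr hadj).trans ?_
      rw [Finset.sum_const, nsmul_eq_mul, hcard]
    calc _ ≤ ((t : ℝ) ^ t) ^ (2 * k) * (T ^ m * (T * B)) := by gcongr
      _ = _ := by rw [hm, pow_succ T m]; ring
  exact le_of_mul_le_mul_left hsum (pow_pos hTpos _)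

/-- There are at most `n ^ x * n ^ y` entries, each at most `1` in absolute value. -/
theorem norm_R_le (H : SimpleGraph α) (e : Fin x ⊕ Fin y ≃ α) (u : Fin x ↪ α) (v : Fin y ↪ α)
    (hu : ∀ i, u i = e (Sum.inl i)) (hv : ∀ j, v j = e (Sum.inr j)) (G : SimpleGraph (Fin n)) :
    ‖R H u v G‖ ≤ (n : ℝ) ^ ((Fintype.card α : ℝ) / 2) := by
  classical
  have hK : ∀ k, Fintype.card (KSubset n k) ≤ n ^ k := fun k => by
    have := Fintype.card_le_of_injective _ (KSubset.list_injective (n := n) (k := k))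
    simpa using this
  have hsq : ‖R H u v G‖ ^ 2 ≤ (n : ℝ) ^ Fintype.card α := by
    refine (Matrix.l2_opNorm_sq_le_sum_sq _).trans ?_
    calc _ ≤ ∑ _A : KSubset n x, ∑ _B : KSubset n y, (1 : ℝ) :=
          Finset.sum_le_sum fun A _ => Finset.sum_le_sum fun B _ =>
            (sq_le_one_iff_abs_le_one _).2 (abs_R_le H e u v hu hv G A B)
      _ = Fintype.card (KSubset n x) * Fintype.card (KSubset n y) := by simp
      _ ≤ (n : ℝ) ^ x * (n : ℝ) ^ y := by
          gcongr
          · exact_mod_cast hK x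
          · exact_mod_cast hK y
      _ = _ := by
          rw [← pow_add, ← Fintype.card_congr e]
          simp
  have hrp : ((n : ℝ) ^ ((Fintype.card α : ℝ) / 2)) ^ 2 = (n : ℝ) ^ Fintype.card α := by
    rw [← Real.rpow_natCast, ← Real.rpow_mul (Nat.cast_nonneg n), ← Real.rpow_natCast]
    congr 1
    push_cast
    ring
  rw [← hrp] at hsq
  exact le_of_sq_le_sq hsq (by positivity)

end Moment

end GraphMatrix

/-! ### Choice of the exponent. -/

namespace GraphMatrix

/-- The comparison of the moment bound with the threshold raised to the same power. -/
theorem moment_bound_le {t q n k : ℕ} (hq : 1 ≤ q) (htq : 2 * q ≤ t) (hn : 1 ≤ n) {ε : ℝ}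
    (hε : 0 < ε) (hε1 : ε < 1) (hk : k = ⌈Real.log (8 * (n : ℝ) ^ q / ε) / (2 * q)⌉₊) :
    ((t : ℝ) ^ t) ^ (2 * k) *
        (((n : ℝ) ^ (k + 1) * (k + 1) ^ (2 * k)) ^ q * (n ^ k) ^ (t - 2 * q)) ≤
      ε / 8 * (2 * (t : ℝ) ^ t *
            (Real.exp 1 * t * (Real.log (8 * (n : ℝ) ^ q / ε) / (2 * q) + 1)) ^ q *
            (n : ℝ) ^ (((t : ℝ) - q) / 2)) ^ (2 * k) := by
  have hn1 : (1 : ℝ) ≤ n := by exact_mod_cast hn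
  have hnq : (1 : ℝ) ≤ (n : ℝ) ^ q := one_le_pow₀ hn1
  have hq0 : (0 : ℝ) < q := by exact_mod_cast hq
  have ht2 : (2 : ℝ) ≤ t := by exact_mod_cast (by omega : 2 ≤ t)
  have harg : 1 ≤ 8 * (n : ℝ) ^ q / ε := by
    rw [le_div_iff₀ hε]
    linarith
  set L := Real.log (8 * (n : ℝ) ^ q / ε) with hL
  have hL0 : 0 ≤ L := Real.log_nonneg harg
  have hexpL : Real.exp L = 8 * (n : ℝ) ^ q / ε := Real.exp_log (by linarith)
  set Z := L / (2 * q) with hZ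
  have hZ0 : 0 ≤ Z := by positivity
  have hkZ : Z ≤ k := hk ▸ Nat.le_ceil Z
  have hkZ' : (k : ℝ) < Z + 1 := hk ▸ Nat.ceil_lt_add_one hZ0
  -- Rounding up costs `k + 1 < Z + 2 ≤ 2 * (Z + 1)`, which the factor `t ≥ 2` absorbs.
  have hk1 : (k : ℝ) + 1 ≤ t * (Z + 1) := by nlinarith
  have hLk : L ≤ (q * (2 * k) : ℕ) := by
    rw [hZ, div_le_iff₀ (by positivity)] at hkZ
    push_cast
    linarith
  -- This dictates `k`: the surplus `n ^ q` is paid for by the factor `e` in the threshold, leaving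
  -- `ε / 8`.
  have hexp : (n : ℝ) ^ q ≤ ε / 8 * Real.exp 1 ^ (q * (2 * k)) := by
    have : Real.exp L ≤ Real.exp 1 ^ (q * (2 * k)) := by
      rw [← Real.exp_nat_mul, mul_one]
      exact Real.exp_le_exp.2 hLk
    rw [hexpL] at this
    calc (n : ℝ) ^ q = ε / 8 * (8 * (n : ℝ) ^ q / ε) := by field_simp
      _ ≤ _ := by gcongr
  have hN : ((n : ℝ) ^ (((t : ℝ) - q) / 2)) ^ (2 * k) = (n : ℝ) ^ (k * (t - q)) := by
    rw [← Real.rpow_natCast, ← Real.rpow_mul (by positivity), ← Real.rpow_natCast]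
    congr 1
    push_cast [Nat.cast_sub (show q ≤ t by omega)]
    ring
  have hleft : ((n : ℝ) ^ (k + 1) * (k + 1) ^ (2 * k)) ^ q * (n ^ k) ^ (t - 2 * q) =
      (n : ℝ) ^ q * ((k : ℝ) + 1) ^ (q * (2 * k)) * (n : ℝ) ^ (k * (t - q)) := by
    obtain ⟨d, rfl⟩ := Nat.exists_eq_add_of_le htq
    rw [Nat.add_sub_cancel_left, show 2 * q + d - q = q + d by omega]
    ring
  -- The leading `2` of the threshold is pure slack.
  have htwo : (1 : ℝ) ≤ 2 ^ (2 * k) := one_le_pow₀ (by norm_num)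
  rw [hleft, mul_pow, hN, mul_pow, mul_pow, ← pow_mul (Real.exp 1 * t * (Z + 1)),
    mul_assoc (Real.exp 1), mul_pow (Real.exp 1)]
  calc _ ≤ ((t : ℝ) ^ t) ^ (2 * k) * (ε / 8 * Real.exp 1 ^ (q * (2 * k)) *
        (t * (Z + 1)) ^ (q * (2 * k)) * (n : ℝ) ^ (k * (t - q))) := by
        gcongr
    _ ≤ 2 ^ (2 * k) * (((t : ℝ) ^ t) ^ (2 * k) * (ε / 8 * Real.exp 1 ^ (q * (2 * k)) *
        (t * (Z + 1)) ^ (q * (2 * k)) * (n : ℝ) ^ (k * (t - q)))) :=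
        le_mul_of_one_le_left (by positivity) htwo
    _ = _ := by ring

end GraphMatrix

/-! ### Assembly by Markov's inequality. -/

theorem mainTheorem2 {α : Type*} [Fintype α] (H : SimpleGraph α) {x y : ℕ}
    (u : Fin x ↪ α) (v : Fin y ↪ α)
    (hH : H.IsBipartiteWith (Set.range u) (Set.range v))
    (huv : Set.range u ∪ Set.range v = Set.univ)
    (t q : ℕ) (ht : Fintype.card α = t) (hq : H.vertexCoverNum = (q : ℕ∞)) (n : ℕ) :
    (∀ G : SimpleGraph (Fin n), ‖GraphMatrix.R H u v G‖ ≤ (n : ℝ) ^ ((t : ℝ) / 2)) ∧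
    (1 ≤ q → ∀ ε : ℝ, 0 < ε → ε < 1 →
      GraphMatrix.gnHalf n
        {G | ‖GraphMatrix.R H u v G‖ >
          2 * (t : ℝ) ^ t *
            (Real.exp 1 * t * (Real.log (8 * (n : ℝ) ^ q / ε) / (2 * q) + 1)) ^ q *
            (n : ℝ) ^ (((t : ℝ) - q) / 2)}
        < ENNReal.ofReal ε) := by
  classical
  have hbij : Function.Bijective (Sum.elim u v) := by
    refine ⟨u.injective.sumElim v.injective fun i j h =>
      Set.disjoint_left.1 hH.disjoint ⟨i, rfl⟩ ⟨j, h.symm⟩, fun a => ?_⟩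
    have ha : a ∈ Set.range u ∪ Set.range v := huv ▸ Set.mem_univ a
    rcases ha with ⟨i, hi⟩ | ⟨j, hj⟩
    · exact ⟨Sum.inl i, hi⟩
    · exact ⟨Sum.inr j, hj⟩
  let e : Fin x ⊕ Fin y ≃ α := Equiv.ofBijective _ hbij
  have hu : ∀ i, u i = e (Sum.inl i) := fun _ => rfl
  have hv : ∀ j, v j = e (Sum.inr j) := fun _ => rfl
  have hfirst : ∀ G : SimpleGraph (Fin n),
      ‖GraphMatrix.R H u v G‖ ≤ (n : ℝ) ^ ((t : ℝ) / 2) := fun G => by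
    simpa only [ht] using GraphMatrix.norm_R_le H e u v hu hv G
  refine ⟨hfirst, fun hq1 ε hε hε1 => ?_⟩
  obtain ⟨p', r', hp', hr', hpr'⟩ := hH.exists_matching_of_vertexCoverNum hq
  choose p hp using fun l => (hpr' l).1
  choose r hr using fun l => (hpr' l).2.1
  have hpinj : Function.Injective p := fun l l' h => hp' (by rw [← hp l, ← hp l', h])
  have hrinj : Function.Injective r := fun l l' h => hr' (by rw [← hr l, ← hr l', h])
  have hadj : ∀ l, H.Adj (e (Sum.inl (p l))) (e (Sum.inr (r l))) := fun l => by
    rw [← hu, ← hv, hp, hr]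
    exact (hpr' l).2.2
  have htq : 2 * q ≤ t := by
    have h1 := Fintype.card_le_of_injective p hpinj
    have h2 := Fintype.card_le_of_injective r hrinj
    have h3 := Fintype.card_congr e
    simp only [Fintype.card_fin, Fintype.card_sum] at h1 h2 h3
    omega
  set thr : ℝ := 2 * (t : ℝ) ^ t *
    (Real.exp 1 * t * (Real.log (8 * (n : ℝ) ^ q / ε) / (2 * q) + 1)) ^ q *
    (n : ℝ) ^ (((t : ℝ) - q) / 2) with hthr
  rcases Nat.eq_zero_or_pos n with hn | hn
  -- For `n = 0` the threshold is `0`, as `q < t`, and the first bound makes the norm `0` too.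
  · have hn0 : (n : ℝ) = 0 := by rw [hn, Nat.cast_zero]
    have hempty : {G : SimpleGraph (Fin n) | ‖GraphMatrix.R H u v G‖ > thr} = ∅ := by
      refine Set.eq_empty_of_forall_notMem fun G hG => ?_
      have hlt : (q : ℝ) < t := by exact_mod_cast (by omega : q < t)
      have ht0 : (0 : ℝ) < t := lt_of_le_of_lt (Nat.cast_nonneg q) hlt
      have h1 := hfirst G
      rw [hn0, Real.zero_rpow (by positivity)] at h1
      have h2 : thr = 0 := by
        rw [hthr, hn0, Real.zero_rpow (by linarith), mul_zero]
      exact absurd (h2 ▸ hG : ‖GraphMatrix.R H u v G‖ > 0) (not_lt.2 h1)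
    rw [hempty, MeasureTheory.measure_empty]
    exact ENNReal.ofReal_pos.2 hε
  · have hnR : (1 : ℝ) ≤ n := by exact_mod_cast hn
    have hL : 0 < Real.log (8 * (n : ℝ) ^ q / ε) := by
      refine Real.log_pos ?_
      rw [lt_div_iff₀ hε]
      have := one_le_pow₀ (n := q) hnR
      linarith
    have htR : (0 : ℝ) < t := by exact_mod_cast (by omega : 0 < t)
    have hqR : (0 : ℝ) < q := by exact_mod_cast hq1
    have hthr0 : 0 < thr := by positivity
    set k := ⌈Real.log (8 * (n : ℝ) ^ q / ε) / (2 * q)⌉₊ with hk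
    have hk0 : k ≠ 0 := (Nat.ceil_pos.2 (by positivity)).ne'
    have : Nonempty α := Fintype.card_pos_iff.1 (by omega)
    have hmom := GraphMatrix.sum_norm_R_pow_le (n := n) H e u v hu hv hk0 p r hpinj hrinj hadj
    have hbd := GraphMatrix.moment_bound_le hq1 htq hn hε hε1 hk
    rw [ht] at hmom
    set D : ℝ := (Fintype.card (SimpleGraph (Fin n)) : ℝ) with hD
    have hD0 : 0 < D := by
      rw [hD]
      exact_mod_cast Fintype.card_pos
    let S : Finset (SimpleGraph (Fin n)) :=
      Finset.univ.filter fun G => ‖GraphMatrix.R H u v G‖ > thr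
    have hS : {G : SimpleGraph (Fin n) | ‖GraphMatrix.R H u v G‖ > thr} =
        (S : Set (SimpleGraph (Fin n))) := by
      ext G
      simp [S]
    have hmarkov : S.card * thr ^ (2 * k) ≤ ε / 8 * D * thr ^ (2 * k) := by
      calc S.card * thr ^ (2 * k) = ∑ _G ∈ S, thr ^ (2 * k) := by
            rw [Finset.sum_const, nsmul_eq_mul]
        _ ≤ ∑ G ∈ S, ‖GraphMatrix.R H u v G‖ ^ (2 * k) :=
            Finset.sum_le_sum fun G hG =>
              pow_le_pow_left₀ hthr0.le (Finset.mem_filter.1 hG).2.le _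
        _ ≤ ∑ G : SimpleGraph (Fin n), ‖GraphMatrix.R H u v G‖ ^ (2 * k) :=
            Finset.sum_le_sum_of_subset_of_nonneg (Finset.subset_univ _) fun G _ _ => by positivity
        _ ≤ _ := hmom
        _ = D * (((t : ℝ) ^ t) ^ (2 * k) *
              (((n : ℝ) ^ (k + 1) * (k + 1) ^ (2 * k)) ^ q * (n ^ k) ^ (t - 2 * q))) := by ring
        _ ≤ D * (ε / 8 * thr ^ (2 * k)) := mul_le_mul_of_nonneg_left hbd hD0.le
        _ = _ := by ring
    have hScard : S.card ≤ ε / 8 * D := le_of_mul_le_mul_right hmarkov (pow_pos hthr0 _)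
    -- Strictness comes from `ε / 8 < ε`.
    rw [hS, GraphMatrix.gnHalf_apply, ENNReal.ofReal_lt_ofReal_iff hε, div_lt_iff₀ hD0]
    nlinarith
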